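/- Let $\mathcal D$ be a dense subspace of a complex Hilbert space $\mathcal H$, and let $\mathcal A$ be an $O^*$-algebra with unit on $\mathcal D$, that is, a unital subalgebra of the algebra of linear operators $\mathcal D\to\mathcal D$ such that for each $\hat A\in\mathcal A$ we have $\mathcal D\subset\operatorname{dom}(\hat A^*)$, $\hat A^*\mathcal D\subset\mathcal D$ and $\hat A^*|_{\mathcal D}\in\mathcal A$. Let $\mathcal T_1(\mathcal A)$ be the set of trace-class operators $\hat T$ on $\mathcal H$ with $\hat T\mathcal H\subset\mathcal D$, $\hat T^*\mathcal H\subset\mathcal D$ and $\hat A\hat T$, $\hat A\hat T^*$ trace class for all $\hat A\in\mathcal A$. Let the state space $X=\mathcal E_S(\mathcal A)$ be the set of positive operators $\rho\in\mathcal T_1(\mathcal A)$ with $\operatorname{Tr}\rho=1$, with the weak topology, generated by the sets $\{\rho : |\operatorname{Tr}\rho\hat A-\operatorname{Tr}\rho_0\hat A|<\epsilon\}$ with $\hat A\in\mathcal A$, $\rho_0\in X$, $\epsilon>0$. For an essentially self-adjoint $\hat A\in\mathcal A$ put $a_Q(\rho)=\operatorname{Tr}\rho\hat A$ for $\rho \in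 X$. Let $\mathbb R_D(X)$ be the sheaf of Dedekind reals of $X$, that is, the sheaf of continuous real functions on open subsets of $X$; let $\mathbb Q_D(X)$ be its subsheaf of locally constant functions with rational values, and let $\mathbb R_D^{a_Q}(X)$ be the sheaf generated by the functions $F(a_Q|_U)$ with $U\subset X$ open and $F:\mathbb R\to\mathbb R$ continuous (its sections over $U$ are the functions on $U$ that are locally of this form). In the internal language of the topos of sheaves on $X$, $\mathbb R_D(X)$ carries the distance $|f-g|$, with values in $\mathbb R_D(X)$, and the metric topology $T$ whose open sets are the subsheaves that contain with each number $x$ a ball $\{y : |x-y|<\epsilon\}$ with $\epsilon>0$. All statements below are understood internally: they refer to numbers over arbitrary open extents $U\subset X$, and "there exists" means existence on the members of an open cover of the extent. Then for every essentially self-adjoint $\hat A\in\mathcal A$: 1. $\mathbb Q_D(X)\subset\mathbb R_D^{a_Q}(X)\subset\mathbb R_D(X)$, and $\mathbb Q_D(X)$ is dense in $\mathbb R_D^{a_Q}(X)$ for the topology induced by $T$: every $T$-open set that contains a number of $\mathbb R_D^{a_Q}(X)$ contains a number of $\mathbb Q_D(X)$. 2. If $\hat A$ is not a constant operator (not a scalar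 multiple of the identity), then $\mathbb R_D^{a_Q}(X)$ is a complete metric space for the distance $|f-g|$: the distance of two numbers of $\mathbb R_D^{a_Q}(X)$ lies in $\mathbb R_D^{a_Q}(X)$, it satisfies the laws of a metric, and every Cauchy sequence of numbers in $\mathbb R_D^{a_Q}(X)$ over an extent $U$ (for all $\epsilon>0$ there is $N$ with $|s_m-s_n|<\epsilon$ for all $m,n\ge N$) converges to a number of $\mathbb R_D^{a_Q}(X)$ over $U$. -/

import Mathlib

open TopologicalSpace

noncomputable section

namespace QRNumbers

/-! ### Trace-class operators -/

section Operators

variable {H : Type*} [NormedAddCommGroup H] [InnerProductSpace ℂ H] [CompleteSpace H]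

variable (H) in
/-- The index set of a fixed orthonormal basis of the Hilbert space `H`. -/
def basisIndex : Set H := (exists_hilbertBasis ℂ H).choose

variable (H) in
/-- A fixed orthonormal basis of the Hilbert space `H`. -/
def basis : HilbertBasis (basisIndex H) ℂ H := (exists_hilbertBasis ℂ H).choose_spec.choose

/-- A bounded operator `T` is trace class if `Tr |T| < ∞`, where `|T| = √(T* T)`. The terms of the
series are nonnegative, and the condition does not depend on the orthonormal basis. -/
def IsTraceClass (T : H →L[ℂ] H) : Prop :=
  Summable fun i => (inner ℂ (basis H i) (CFC.abs T (basis H i))).re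

/-- An everywhere defined linear operator is trace class if it is bounded and trace class. -/
def IsTraceClassLinear (T : H →ₗ[ℂ] H) : Prop :=
  ∃ B : H →L[ℂ] H, (B : H →ₗ[ℂ] H) = T ∧ IsTraceClass B

/-- The trace `Tr T = ∑ ⟨e, T e⟩`; it is used only for trace-class `T`. -/
def trace (T : H →ₗ[ℂ] H) : ℂ :=
  ∑' i, inner ℂ (basis H i) (T (basis H i))

/-! ### O*-algebras and their state spaces -/

/-- An O*-algebra with unit on the (dense) subspace `D`: a subalgebra of the algebra of all linear
operators `D → D` such that every element `A` has an adjoint `A†` (with `⟨A x, y⟩ = ⟨x, A† y⟩` on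
`D`, that is, `D ⊆ dom A*`, `A* D ⊆ D` and `A† = A*|_D`) which lies in the algebra again. -/
structure OStarAlgebra (D : Submodule ℂ H) extends Subalgebra ℂ (Module.End ℂ D) where
  exists_adjoint : ∀ A ∈ carrier, ∃ B ∈ carrier, ∀ x y : D,
    inner ℂ ((A x : D) : H) (y : H) = inner ℂ (x : H) ((B y : D) : H)

variable {D : Submodule ℂ H}

/-- An operator `A` with domain `D` is essentially self-adjoint if its closure is self-adjoint. -/
def IsEssentiallySelfAdjoint (A : Module.End ℂ D) : Prop :=
  IsSelfAdjoint (LinearPMap.closure (⟨D, D.subtype ∘ₗ A⟩ : H →ₗ.[ℂ] H))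

/-- A constant operator: a scalar multiple of the identity of `D`. -/
def IsConstantOperator (A : Module.End ℂ D) : Prop := ∃ c : ℂ, A = c • (1 : Module.End ℂ D)

/-- The product `A T : H → H` of an operator `A : D → D` with an operator `T` with range in `D`. -/
def opMul (A : Module.End ℂ D) (T : H →L[ℂ] H) (hT : ∀ v, T v ∈ D) : H →ₗ[ℂ] H :=
  D.subtype ∘ₗ A ∘ₗ LinearMap.codRestrict D (T : H →ₗ[ℂ] H) hT

/-- The set `𝒯₁(𝒜)` of the trace-class operators `T` with `T H ⊆ D`, `T* H ⊆ D` such that `A T` and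
`A T*` are trace class for all `A ∈ 𝒜`. -/
structure IsTraceClassFor (𝒜 : OStarAlgebra D) (T : H →L[ℂ] H) : Prop where
  traceClass : IsTraceClass T
  range_le : ∀ v, T v ∈ D
  adjoint_range_le : ∀ v, ContinuousLinearMap.adjoint T v ∈ D
  mul_traceClass : ∀ A ∈ 𝒜.carrier, IsTraceClassLinear (opMul A T range_le)
  mul_adjoint_traceClass : ∀ A ∈ 𝒜.carrier,
    IsTraceClassLinear (opMul A (ContinuousLinearMap.adjoint T) adjoint_range_le)

/-- The state space of the O*-algebra `𝒜`: positive (self-adjoint) operators in `𝒯₁(𝒜)` with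
trace `1`. -/
structure StateSpace (𝒜 : OStarAlgebra D) where
  /-- The density operator of the state. -/
  op : H →L[ℂ] H
  mem : IsTraceClassFor 𝒜 op
  isPositive : op.IsPositive
  trace_eq_one : trace (op : H →ₗ[ℂ] H) = 1

variable {𝒜 : OStarAlgebra D}

/-- The expectation `Tr (A ρ)` of the operator `A` in the state `ρ`. -/
def expectation (A : Module.End ℂ D) (ρ : StateSpace 𝒜) : ℂ :=
  trace (opMul A ρ.op ρ.mem.range_le)

/-- The weak topology of the state space, with the sub-basic open sets
`{ρ | |Tr (A ρ) - Tr (A ρ₀)| < ε}` for `A ∈ 𝒜`, `ρ₀` a state, `ε > 0`. -/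
instance : TopologicalSpace (StateSpace 𝒜) :=
  TopologicalSpace.generateFrom
    {N | ∃ A ∈ 𝒜.carrier, ∃ ρ₀ : StateSpace 𝒜, ∃ ε : ℝ, 0 < ε ∧
      N = {ρ | ‖expectation A ρ - expectation A ρ₀‖ < ε}}

/-- The real function `a_Q(ρ) = Tr (ρ A)` on the state space. (For symmetric `A` the trace is real,
so that taking the real part changes nothing.) -/
def qValue (𝒜 : OStarAlgebra D) (A : Module.End ℂ D) (ρ : StateSpace 𝒜) : ℝ :=
  (expectation A ρ).re

end Operators

/-! ### Dedekind reals in the topos of sheaves on a space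

A subsheaf of the sheaf of all real functions on `X` is given by a local predicate: it says which
functions on the open sets `U` are sections, is stable under restriction, and can be checked locally.
-/

section Sheaves

variable {X : TopCat}

variable (X) in
/-- The sheaf of Dedekind reals of `X`: continuous real functions on the open sets of `X`. -/
def dedekindReals : TopCat.LocalPredicate (fun _ : X => ℝ) := TopCat.continuousLocal X ℝ

variable (X) in
/-- The sheaf of rational numbers of `X`: locally constant functions with rational values. -/
def rationals : TopCat.LocalPredicate (fun _ : X => ℝ) :=
  TopCat.PrelocalPredicate.sheafify
    { pred := fun {U} f => ∃ q : ℚ, ∀ x : U, f x = (q : ℝ)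
      res := fun i _ h => ⟨h.choose, fun x => h.choose_spec (i x)⟩ }

/-- The sheaf of numbers generated by a real function `a` on `X`: the sheaf generated by the
functions `F ∘ a|_U` with `U` open in `X` and `F : ℝ → ℝ` continuous. Its sections are the functions
that have this form locally. -/
def generatedReals (a : X → ℝ) : TopCat.LocalPredicate (fun _ : X => ℝ) :=
  TopCat.PrelocalPredicate.sheafify
    { pred := fun {U} f => ∃ F : ℝ → ℝ, Continuous F ∧ ∀ x : U, f x = F (a x)
      res := fun i _ h => ⟨h.choose, h.choose_spec.1, fun x => h.choose_spec.2 (i x)⟩ }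

/-- Inclusion of subsheaves. -/
def IsSubsheaf (P Q : TopCat.LocalPredicate (fun _ : X => ℝ)) : Prop :=
  ∀ (U : Opens X) (f : U → ℝ), P.pred f → Q.pred f

/-- Restriction of a function to a smaller open set. -/
def restrict {U V : Opens X} (h : V ≤ U) (f : U → ℝ) : V → ℝ := fun x => f ⟨x, h x.2⟩

/-- The strict order of the Dedekind reals over the extent `U`. -/
def Less {U : Opens X} (f g : U → ℝ) : Prop := ∀ x, f x < g x

/-- The order `≤` of the Dedekind reals over the extent `U`. -/
def LessEq {U : Opens X} (f g : U → ℝ) : Prop := ∀ x, f x ≤ g x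

/-- The distance of two Dedekind reals over the extent `U`, again a Dedekind real over `U`. -/
def sdist {U : Opens X} (f g : U → ℝ) : U → ℝ := fun x => |f x - g x|

/-- A positive Dedekind real over the extent `U`. -/
def IsPosReal {U : Opens X} (ε : U → ℝ) : Prop := (dedekindReals X).pred ε ∧ Less (fun _ => 0) ε

/-- `Covered U P`: the open set `U` is covered by open subsets `V ≤ U` for which `P` holds. This is
the meaning of "there exists" over the extent `U` in the internal logic of sheaves on `X`. -/
def Covered (U : Opens X) (P : ∀ V : Opens X, V ≤ U → Prop) : Prop :=
  ∀ p ∈ U, ∃ (V : Opens X) (h : V ≤ U), p ∈ V ∧ P V h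

/-- The open sets of the metric topology `T` on the object of Dedekind reals: the subsheaves `S` of
the sheaf of Dedekind reals such that, in the internal logic, with each number `x` in `S` there is a
positive `ε` for which the ball of radius `ε` about `x` is contained in `S`. (A subsheaf over an
extent `U` is a subsheaf that has sections only over subsets of `U`.) -/
def IsMetricOpen (S : TopCat.LocalPredicate (fun _ : X => ℝ)) : Prop :=
  IsSubsheaf S (dedekindReals X) ∧
  ∀ (U : Opens X) (x : U → ℝ), S.pred x →
    Covered U fun V hV => ∃ ε : V → ℝ, IsPosReal ε ∧
      ∀ (W : Opens X) (hW : W ≤ V) (y : W → ℝ), (dedekindReals X).pred y →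
        Less (sdist (restrict hW (restrict hV x)) y) (restrict hW ε) → S.pred y

/-- The subsheaf `Q` of `R` is dense in the subsheaf `R` of the Dedekind reals, for the topology that
the metric topology `T` induces on `R`: internally, every open set of `T` that contains a number of
`R` contains a number of `Q`. -/
def IsMetricDense (Q R : TopCat.LocalPredicate (fun _ : X => ℝ)) : Prop :=
  IsSubsheaf Q R ∧ IsSubsheaf R (dedekindReals X) ∧
  ∀ (U : Opens X) (x : U → ℝ), R.pred x →
    ∀ S : TopCat.LocalPredicate (fun _ : X => ℝ), IsMetricOpen S → S.pred x →
      Covered U fun V _ => ∃ q : V → ℝ, Q.pred q ∧ S.pred q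

/-- The sequence `s` over the extent `U` is a Cauchy sequence, in the internal logic:
for all `ε > 0` there is `N` such that `|s m - s n| < ε` for all `m, n ≥ N`. -/
def IsCauchySequence {U : Opens X} (s : ℕ → U → ℝ) : Prop :=
  ∀ (V : Opens X) (hV : V ≤ U) (ε : V → ℝ), IsPosReal ε →
    Covered V fun _ hW => ∃ N : ℕ, ∀ m ≥ N, ∀ n ≥ N,
      Less (sdist (restrict hW (restrict hV (s m))) (restrict hW (restrict hV (s n))))
        (restrict hW ε)

/-- The sequence `s` over the extent `U` converges to `f`, in the internal logic:
for all `ε > 0` there is `N` such that `|s n - f| < ε` for all `n ≥ N`. -/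
def ConvergesTo {U : Opens X} (s : ℕ → U → ℝ) (f : U → ℝ) : Prop :=
  ∀ (V : Opens X) (hV : V ≤ U) (ε : V → ℝ), IsPosReal ε →
    Covered V fun _ hW => ∃ N : ℕ, ∀ n ≥ N,
      Less (sdist (restrict hW (restrict hV (s n))) (restrict hW (restrict hV f)))
        (restrict hW ε)

/-- The subsheaf `R` of the Dedekind reals is a complete metric space for the distance `|f - g|`,
with values in `R`: over every extent the distance satisfies the laws of a metric, and every Cauchy
sequence of numbers in `R` converges to a number in `R`. -/
structure IsCompleteMetric (R : TopCat.LocalPredicate (fun _ : X => ℝ)) : Prop where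
  isSubsheaf : IsSubsheaf R (dedekindReals X)
  dist_mem : ∀ (U : Opens X) (f g : U → ℝ), R.pred f → R.pred g → R.pred (sdist f g)
  dist_nonneg : ∀ (U : Opens X) (f g : U → ℝ), R.pred f → R.pred g →
    LessEq (fun _ => 0) (sdist f g)
  dist_eq_zero : ∀ (U : Opens X) (f g : U → ℝ), R.pred f → R.pred g →
    (sdist f g = (fun _ => 0) ↔ f = g)
  dist_comm : ∀ (U : Opens X) (f g : U → ℝ), R.pred f → R.pred g → sdist f g = sdist g f
  dist_triangle : ∀ (U : Opens X) (f g h : U → ℝ), R.pred f → R.pred g → R.pred h →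
    LessEq (sdist f h) (fun x => sdist f g x + sdist g h x)
  complete : ∀ (U : Opens X) (s : ℕ → U → ℝ), (∀ n, R.pred (s n)) → IsCauchySequence s →
    ∃ f : U → ℝ, R.pred f ∧ ConvergesTo s f

end Sheaves

/-- The sheaf of qr-numbers generated by the operator `A`, on the state space of `𝒜`. -/
def qrNumbers {H : Type*} [NormedAddCommGroup H] [InnerProductSpace ℂ H] [CompleteSpace H]
    {D : Submodule ℂ H} (𝒜 : OStarAlgebra D) (A : Module.End ℂ D) :
    TopCat.LocalPredicate (fun _ : TopCat.of (StateSpace 𝒜) => ℝ) :=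
  generatedReals (X := TopCat.of (StateSpace 𝒜)) (qValue 𝒜 A)

end QRNumbers

end

/-!
The weak topology of the state space `X` has a basis of open sets that are convex under mixing of
states, and `a_Q` is continuous and affine. Everything else follows from this.

*Mixtures are states.* With trace class defined by `∑ ⟨e, |T| e⟩ < ∞` for one orthonormal basis, one
needs that trace-class operators form a vector space on which the trace is linear. Trace-class
operators are products of two Hilbert-Schmidt operators, and conversely `|B* C + B'* C'|` has summable
diagonal, because Hilbert-Schmidt operators form a two-sided ideal; the polar decomposition comes from
Douglas' factorization lemma (`IsTraceClass.smul_add_smul`, `trace_smul_add_smul`).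

*Density.* Near any point a continuous function is within `ε` of a rational constant.

*Completeness.* A Cauchy sequence converges locally uniformly to a continuous function `f`; the
question is whether `f` is locally a continuous function of `a_Q`. On a convex open set `W` the fibres
of `a_Q` are connected by segments, on which every section of the sheaf is locally constant, hence
constant (`AffineSegments.section_eq_of_eq`). So all terms of the sequence, and therefore `f`, are
constant on the fibres of `a_Q` in the same set `W`. Near `ρ ∈ W` a segment from `ρ` on which `a_Q`
increases is a continuous right inverse of `a_Q`, and `f` along it is a continuous function of the
value of `a_Q`; likewise for a segment on which `a_Q` decreases. If one of these segments does not
exist, `a_Q(ρ)` is an extreme value of `a_Q` on `W` and a constant serves on that side. Gluing the two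
sides gives `f = F ∘ a_Q` near `ρ` (`AffineSegments.generatedReals_of_fibres`). For a constant operator
the same argument applies, with both sides constant.
-/

noncomputable section

namespace QRNumbers

/-! ### Hilbert-Schmidt and trace-class operators -/

section TraceClass

variable {H : Type*} [NormedAddCommGroup H] [InnerProductSpace ℂ H] [CompleteSpace H]

/-- A form of Douglas' lemma: an operator dominated pointwise in norm by `T` factors through `T`.
Since `‖T x‖ = ‖|T| x‖`, it supplies both halves of the polar decomposition. -/
theorem exists_comp_eq_of_norm_le {S T : H →L[ℂ] H} (h : ∀ x, ‖S x‖ ≤ ‖T x‖) :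
    ∃ U : H →L[ℂ] H, U ∘L T = S := by
  let K : Submodule ℂ H := (LinearMap.range (T : H →ₗ[ℂ] H)).topologicalClosure
  have : CompleteSpace K := (Submodule.isClosed_topologicalClosure _).completeSpace_coe
  have hTK : ∀ x, T x ∈ K := fun x =>
    Submodule.le_topologicalClosure _ (LinearMap.mem_range_self (T : H →ₗ[ℂ] H) x)
  let e : H →ₗ[ℂ] K := LinearMap.codRestrict K (T : H →ₗ[ℂ] H) hTK
  have he : DenseRange e := by
    intro y
    rw [closure_subtype, ← Set.range_comp]
    exact y.2
  let V : K →L[ℂ] H := LinearMap.extendOfNorm (S : H →ₗ[ℂ] H) e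
  have hV : ∀ x, V (e x) = S x := fun x =>
    LinearMap.extendOfNorm_eq he ⟨1, fun x => by simpa [e] using h x⟩ x
  refine ⟨V ∘L K.orthogonalProjectionOnto, ?_⟩
  ext x
  have : K.orthogonalProjectionOnto (T x) = e x :=
    Submodule.orthogonalProjectionOnto_mem_subspace_eq_self (K := K) (e x)
  simp [this, hV]

theorem norm_abs_apply (T : H →L[ℂ] H) (x : H) : ‖CFC.abs T x‖ = ‖T x‖ := by
  have key : ContinuousLinearMap.adjoint (CFC.abs T) * CFC.abs T
      = ContinuousLinearMap.adjoint T * T := by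
    have := CFC.abs_mul_abs T
    have h2 : star (CFC.abs T) = CFC.abs T := (CFC.abs_nonneg T).isSelfAdjoint.star_eq
    rw [← ContinuousLinearMap.star_eq_adjoint, ← ContinuousLinearMap.star_eq_adjoint, h2, this]
  have h3 : ∀ S : H →L[ℂ] H,
      inner ℂ ((ContinuousLinearMap.adjoint S * S) x) x = inner ℂ (S x) (S x) := fun S => by
    rw [mul_apply_eq_comp, ContinuousLinearMap.adjoint_inner_left]
  have h4 := (h3 (CFC.abs T)).symm.trans ((congrArg (fun R : H →L[ℂ] H => inner ℂ (R x) x) key).trans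
    (h3 T))
  rw [inner_self_eq_norm_sq_to_K, inner_self_eq_norm_sq_to_K] at h4
  exact (sq_eq_sq₀ (norm_nonneg _) (norm_nonneg _)).1 (by exact_mod_cast h4)

/-- A Hilbert-Schmidt operator, defined, as `IsTraceClass` is, with the fixed orthonormal basis. -/
def IsHilbertSchmidt (B : H →L[ℂ] H) : Prop :=
  Summable fun i => ‖B (basis H i)‖ ^ 2

theorem hasSum_norm_inner_basis_sq (x : H) :
    HasSum (fun i => ‖inner ℂ (basis H i) x‖ ^ 2) (‖x‖ ^ 2) := by
  have h := (basis H).hasSum_inner_mul_inner x x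
  simp only [← inner_conj_symm x (basis H _), Complex.conj_mul',
    inner_self_eq_norm_sq_to_K] at h
  rw [← Complex.hasSum_ofReal]
  push_cast
  exact h

theorem IsHilbertSchmidt.adjoint {B : H →L[ℂ] H} (hB : IsHilbertSchmidt B) :
    IsHilbertSchmidt (ContinuousLinearMap.adjoint B) := by
  have hsum : Summable fun p : basisIndex H × basisIndex H =>
      ‖inner ℂ (basis H p.2) (B (basis H p.1))‖ ^ 2 := by
    rw [summable_prod_of_nonneg (fun _ => by positivity)]
    refine ⟨fun i => (hasSum_norm_inner_basis_sq (B (basis H i))).summable, ?_⟩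
    simp only [(hasSum_norm_inner_basis_sq _).tsum_eq]
    exact hB
  refine hsum.prod_symm.prod.congr fun j => ?_
  rw [← (hasSum_norm_inner_basis_sq _).tsum_eq]
  refine tsum_congr fun i => ?_
  rw [ContinuousLinearMap.adjoint_inner_right, norm_inner_symm]
  rfl

theorem IsHilbertSchmidt.comp_left {B : H →L[ℂ] H} (hB : IsHilbertSchmidt B) (U : H →L[ℂ] H) :
    IsHilbertSchmidt (U ∘L B) := by
  refine Summable.of_nonneg_of_le (fun _ => by positivity) (fun i => ?_)
    (Summable.mul_left (‖U‖ ^ 2) hB)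
  rw [← mul_pow]
  exact pow_le_pow_left₀ (norm_nonneg _) (U.le_opNorm _) 2

theorem IsHilbertSchmidt.comp_right {B : H →L[ℂ] H} (hB : IsHilbertSchmidt B) (U : H →L[ℂ] H) :
    IsHilbertSchmidt (B ∘L U) := by
  have := (hB.adjoint.comp_left (ContinuousLinearMap.adjoint U)).adjoint
  rwa [ContinuousLinearMap.adjoint_comp, ContinuousLinearMap.adjoint_adjoint,
    ContinuousLinearMap.adjoint_adjoint] at this

theorem IsHilbertSchmidt.summable_inner {B C : H →L[ℂ] H} (hB : IsHilbertSchmidt B)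
    (hC : IsHilbertSchmidt C) :
    Summable fun i => inner ℂ (B (basis H i)) (C (basis H i)) := by
  refine Summable.of_norm_bounded (Summable.add hB hC) fun i => ?_
  refine (norm_inner_le_norm _ _).trans ?_
  nlinarith [sq_nonneg (‖B (basis H i)‖ - ‖C (basis H i)‖), sq_nonneg ‖B (basis H i)‖,
    sq_nonneg ‖C (basis H i)‖]

/-- A trace-class operator is a product of two Hilbert-Schmidt operators: with the polar
decomposition `T = U |T|` it is the product of `U √|T|` and `√|T|`. -/
theorem IsTraceClass.exists_factor {T : H →L[ℂ] H} (hT : IsTraceClass T) :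
    ∃ B C : H →L[ℂ] H, IsHilbertSchmidt B ∧ IsHilbertSchmidt C ∧
      T = ContinuousLinearMap.adjoint B ∘L C := by
  obtain ⟨U, hU⟩ := exists_comp_eq_of_norm_le (S := T) (T := CFC.abs T)
    fun x => (norm_abs_apply T x).ge
  set R : H →L[ℂ] H := CFC.sqrt (CFC.abs T) with hR
  have hRR : R * R = CFC.abs T := CFC.sqrt_mul_sqrt_self _ (CFC.abs_nonneg T)
  have hRa : ContinuousLinearMap.adjoint R = R := (CFC.sqrt_nonneg (CFC.abs T)).isSelfAdjoint.star_eq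
  have hHS : IsHilbertSchmidt R := by
    refine Summable.congr hT fun i => ?_
    rw [← hRR, mul_apply_eq_comp, ← ContinuousLinearMap.adjoint_inner_left, hRa,
      inner_self_eq_norm_sq_to_K]
    norm_cast
  refine ⟨R ∘L ContinuousLinearMap.adjoint U, R, hHS.comp_right _, hHS, ?_⟩
  rw [ContinuousLinearMap.adjoint_comp, ContinuousLinearMap.adjoint_adjoint, hRa,
    ContinuousLinearMap.comp_assoc]
  exact (hRR ▸ hU).symm

theorem IsTraceClass.summable_inner {T : H →L[ℂ] H} (hT : IsTraceClass T) :
    Summable fun i => inner ℂ (basis H i) (T (basis H i)) := by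
  obtain ⟨B, C, hB, hC, rfl⟩ := hT.exists_factor
  simpa [ContinuousLinearMap.adjoint_inner_right] using hB.summable_inner hC

/-- Trace-class operators form a vector space. If `T = B* C` and `S = B'* C'`, then
`|c T + d S| = V (c T + d S)`, for some bounded `V`, is again a combination of products of Hilbert-Schmidt operators. -/
theorem IsTraceClass.smul_add_smul {T S : H →L[ℂ] H} (hT : IsTraceClass T) (hS : IsTraceClass S)
    (c d : ℂ) : IsTraceClass (c • T + d • S) := by
  obtain ⟨V, hV⟩ := exists_comp_eq_of_norm_le (S := CFC.abs (c • T + d • S)) (T := c • T + d • S)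
    fun x => (norm_abs_apply _ x).le
  obtain ⟨B, C, hB, hC, rfl⟩ := hT.exists_factor
  obtain ⟨B', C', hB', hC', rfl⟩ := hS.exists_factor
  have h1 := ((hB.comp_right (ContinuousLinearMap.adjoint V)).summable_inner hC).mul_left c
  have h2 := ((hB'.comp_right (ContinuousLinearMap.adjoint V)).summable_inner hC').mul_left d
  refine ((Complex.hasSum_re (h1.add h2).hasSum).summable).congr fun i => ?_
  rw [← hV]
  simp [ContinuousLinearMap.adjoint_inner_right,
    ← ContinuousLinearMap.adjoint_inner_left V]

theorem IsTraceClassLinear.summable_inner {T : H →ₗ[ℂ] H} (hT : IsTraceClassLinear T) :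
    Summable fun i => inner ℂ (basis H i) (T (basis H i)) := by
  obtain ⟨B, rfl, hB⟩ := hT
  exact hB.summable_inner

theorem IsTraceClassLinear.smul_add_smul {T S : H →ₗ[ℂ] H} (hT : IsTraceClassLinear T)
    (hS : IsTraceClassLinear S) (c d : ℂ) : IsTraceClassLinear (c • T + d • S) := by
  obtain ⟨B, rfl, hB⟩ := hT
  obtain ⟨C, rfl, hC⟩ := hS
  exact ⟨c • B + d • C, rfl, hB.smul_add_smul hC c d⟩

theorem trace_smul_add_smul {T S : H →ₗ[ℂ] H} (hT : IsTraceClassLinear T)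
    (hS : IsTraceClassLinear S) (c d : ℂ) :
    trace (c • T + d • S) = c * trace T + d * trace S := by
  simp only [trace, LinearMap.add_apply, LinearMap.smul_apply, inner_add_right, inner_smul_right]
  rw [(hT.summable_inner.mul_left c).tsum_add (hS.summable_inner.mul_left d), tsum_mul_left,
    tsum_mul_left]

end TraceClass

/-! ### Convexity of the state space -/

section States

variable {H : Type*} [NormedAddCommGroup H] [InnerProductSpace ℂ H]
variable {D : Submodule ℂ H}

theorem smul_add_smul_mem {T S : H →L[ℂ] H} (hT : ∀ v, T v ∈ D) (hS : ∀ v, S v ∈ D) (c d : ℂ)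
    (v : H) : (c • T + d • S) v ∈ D :=
  D.add_mem (D.smul_mem c (hT v)) (D.smul_mem d (hS v))

theorem opMul_smul_add_smul (A : Module.End ℂ D) {T S : H →L[ℂ] H} (hT : ∀ v, T v ∈ D)
    (hS : ∀ v, S v ∈ D) (c d : ℂ) (h : ∀ v, (c • T + d • S) v ∈ D) :
    opMul A (c • T + d • S) h = c • opMul A T hT + d • opMul A S hS := by
  ext v
  have : (⟨(c • T + d • S) v, h v⟩ : D) = c • ⟨T v, hT v⟩ + d • ⟨S v, hS v⟩ := rfl
  change ((A ⟨(c • T + d • S) v, h v⟩ : D) : H) = _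
  rw [this, map_add, map_smul, map_smul]
  rfl

variable [CompleteSpace H] {𝒜 : OStarAlgebra D}

theorem IsTraceClassFor.smul_add_smul {T S : H →L[ℂ] H} (hT : IsTraceClassFor 𝒜 T)
    (hS : IsTraceClassFor 𝒜 S) (c d : ℂ) : IsTraceClassFor 𝒜 (c • T + d • S) := by
  have hadj : ContinuousLinearMap.adjoint (c • T + d • S) =
      star c • ContinuousLinearMap.adjoint T + star d • ContinuousLinearMap.adjoint S := by
    rw [map_add, map_smulₛₗ, map_smulₛₗ]
    rfl
  refine ⟨hT.traceClass.smul_add_smul hS.traceClass c d,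
    smul_add_smul_mem hT.range_le hS.range_le c d,
    fun v => hadj ▸ smul_add_smul_mem hT.adjoint_range_le hS.adjoint_range_le _ _ v,
    fun A hA => ?_, fun A hA => ?_⟩
  · rw [opMul_smul_add_smul A hT.range_le hS.range_le]
    exact (hT.mul_traceClass A hA).smul_add_smul (hS.mul_traceClass A hA) c d
  · simp only [hadj]
    rw [opMul_smul_add_smul A hT.adjoint_range_le hS.adjoint_range_le]
    exact (hT.mul_adjoint_traceClass A hA).smul_add_smul (hS.mul_adjoint_traceClass A hA) _ _

/-- The state `(1 - t) ρ + t σ`. -/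
def mix (ρ σ : StateSpace 𝒜) (t : unitInterval) : StateSpace 𝒜 where
  op := ((1 - t : ℝ) : ℂ) • ρ.op + ((t : ℝ) : ℂ) • σ.op
  mem := ρ.mem.smul_add_smul σ.mem _ _
  isPositive := by
    refine (ρ.isPositive.smul_of_nonneg ?_).add (σ.isPositive.smul_of_nonneg ?_)
    · exact_mod_cast sub_nonneg.2 t.2.2
    · exact_mod_cast t.2.1
  trace_eq_one := by
    have h := trace_smul_add_smul (T := (ρ.op : H →ₗ[ℂ] H)) (S := σ.op)
      ⟨_, rfl, ρ.mem.traceClass⟩ ⟨_, rfl, σ.mem.traceClass⟩ ((1 - t : ℝ) : ℂ) ((t : ℝ) : ℂ)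
    rw [ρ.trace_eq_one, σ.trace_eq_one] at h
    refine h.trans ?_
    push_cast
    ring

theorem StateSpace.ext_op {ρ σ : StateSpace 𝒜} (h : ρ.op = σ.op) : ρ = σ := by
  cases ρ
  cases σ
  cases h
  rfl

theorem mix_zero (ρ σ : StateSpace 𝒜) : mix ρ σ 0 = ρ := StateSpace.ext_op (by simp [mix])

theorem mix_one (ρ σ : StateSpace 𝒜) : mix ρ σ 1 = σ := StateSpace.ext_op (by simp [mix])

theorem expectation_mix {A : Module.End ℂ D} (hA : A ∈ 𝒜.carrier) (ρ σ : StateSpace 𝒜)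
    (t : unitInterval) :
    expectation A (mix ρ σ t) =
      ((1 - t : ℝ) : ℂ) * expectation A ρ + ((t : ℝ) : ℂ) * expectation A σ := by
  rw [expectation, expectation, expectation,
    ← trace_smul_add_smul (ρ.mem.mul_traceClass A hA) (σ.mem.mul_traceClass A hA),
    ← opMul_smul_add_smul A ρ.mem.range_le σ.mem.range_le _ _
      (smul_add_smul_mem ρ.mem.range_le σ.mem.range_le _ _)]
  rfl

theorem qValue_mix {A : Module.End ℂ D} (hA : A ∈ 𝒜.carrier) (ρ σ : StateSpace 𝒜)
    (t : unitInterval) :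
    qValue 𝒜 A (mix ρ σ t) = (1 - t) * qValue 𝒜 A ρ + t * qValue 𝒜 A σ := by
  simp [qValue, expectation_mix hA, Complex.add_re, -Complex.ofReal_sub]

theorem continuous_expectation {A : Module.End ℂ D} (hA : A ∈ 𝒜.carrier) :
    Continuous (expectation A : StateSpace 𝒜 → ℂ) := by
  rw [continuous_iff_continuousAt]
  intro ρ
  rw [ContinuousAt, Metric.tendsto_nhds]
  intro ε hε
  refine IsOpen.mem_nhds (isOpen_generateFrom_of_mem ⟨A, hA, ρ, ε, hε, ?_⟩) ?_
  · simp only [dist_eq_norm]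
  · simpa using hε

theorem continuous_qValue {A : Module.End ℂ D} (hA : A ∈ 𝒜.carrier) :
    Continuous (qValue 𝒜 A) :=
  Complex.continuous_re.comp (continuous_expectation hA)

theorem continuous_mix (ρ σ : StateSpace 𝒜) : Continuous (mix ρ σ) := by
  refine continuous_generateFrom_iff.2 ?_
  rintro _ ⟨A, hA, ρ₀, ε, hε, rfl⟩
  simp only [Set.preimage_ofPred_eq, expectation_mix hA]
  exact isOpen_lt (by fun_prop) continuous_const

/-- The weak topology is locally convex: its sub-basic sets are preimages of balls under affine
maps. -/
theorem exists_convex_nhd (U : Opens (StateSpace 𝒜)) {p : StateSpace 𝒜} (hp : p ∈ U) :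
    ∃ W : Opens (StateSpace 𝒜), p ∈ W ∧ W ≤ U ∧ ∀ x ∈ W, ∀ y ∈ W, ∀ t, mix x y t ∈ W := by
  obtain ⟨_, ⟨f, ⟨hfin, hf⟩, rfl⟩, hpW, hWU⟩ :=
    (isTopologicalBasis_of_subbasis (α := StateSpace 𝒜) rfl).exists_subset_of_mem_open hp U.2
  refine ⟨⟨⋂₀ f, hfin.isOpen_sInter fun s hs => isOpen_generateFrom_of_mem (hf hs)⟩, hpW, hWU,
    fun x hx y hy t s hs => ?_⟩
  have hxs := hx s hs
  have hys := hy s hs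
  obtain ⟨A, hA, ρ₀, ε, hε, rfl⟩ := hf hs
  simp only [Set.mem_ofPred_eq, ← dist_eq_norm, ← Metric.mem_ball] at hxs hys ⊢
  rw [expectation_mix hA]
  exact convex_ball _ _ hxs hys (sub_nonneg.2 t.2.2) t.2.1 (sub_add_cancel _ _)

end States

/-! ### Sheaves of functions generated by one function -/

section Generated

variable {X : TopCat}

theorem rationals_isSubsheaf (a : X → ℝ) : IsSubsheaf (rationals X) (generatedReals a) := by
  intro U f hf x
  obtain ⟨V, m, i, q, hq⟩ := hf x
  exact ⟨V, m, i, fun _ => q, continuous_const, hq⟩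

theorem generatedReals_isSubsheaf {a : X → ℝ} (ha : Continuous a) :
    IsSubsheaf (generatedReals a) (dedekindReals X) := by
  refine fun U f hf => (dedekindReals X).locality f fun x => ?_
  obtain ⟨V, m, i, F, hF, h⟩ := hf x
  refine ⟨V, m, i, ?_⟩
  change Continuous _
  simp only [h]
  exact hF.comp (ha.comp continuous_subtype_val)

theorem generatedReals_sdist {a : X → ℝ} {U : Opens X} {f g : U → ℝ}
    (hf : (generatedReals a).pred f) (hg : (generatedReals a).pred g) :
    (generatedReals a).pred (sdist f g) := by
  intro x
  obtain ⟨V, m, i, F, hF, h⟩ := hf x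
  obtain ⟨V', m', i', G, hG, h'⟩ := hg x
  refine ⟨V ⊓ V', ⟨m, m'⟩, CategoryTheory.homOfLE (inf_le_left.trans i.le), fun r => |F r - G r|, (hF.sub hG).abs,
    fun y => ?_⟩
  exact congrArg₂ (fun u v => |u - v|) (h ⟨y, y.2.1⟩) (h' ⟨y, y.2.2⟩)

/-- A rational constant close to `x` at a point is close to `x` in a neighbourhood of that point. -/
theorem rationals_dense {R : TopCat.LocalPredicate (fun _ : X => ℝ)}
    (hQ : IsSubsheaf (rationals X) R) (hR : IsSubsheaf R (dedekindReals X)) :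
    IsMetricDense (rationals X) R := by
  refine ⟨hQ, hR, fun U x hx S hS hxS p hp => ?_⟩
  obtain ⟨V, hVU, hpV, ε, ⟨hεc, hε⟩, hball⟩ := hS.2 U x hxS p hp
  obtain ⟨q, hq⟩ := Rat.denseRange_cast (𝕜 := ℝ).exists_dist_lt (x ⟨p, hp⟩) (hε ⟨p, hpV⟩)
  have hxc : Continuous (restrict hVU x) :=
    (show Continuous x from hR U x hx).comp (Opens.isOpenEmbedding_of_le hVU).continuous
  have hεc : Continuous ε := hεc
  have hopen : IsOpen {y : V | |restrict hVU x y - q| < ε y} :=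
    isOpen_lt (hxc.sub continuous_const).abs hεc
  let W : Opens X := ⟨(↑) '' {y : V | |restrict hVU x y - q| < ε y},
    V.isOpen.isOpenMap_subtype_val _ hopen⟩
  have hWV : W ≤ V := by
    rintro _ ⟨y, -, rfl⟩
    exact y.2
  refine ⟨W, hWV.trans hVU, ⟨⟨p, hpV⟩, hq, rfl⟩, fun _ => q,
    TopCat.PrelocalPredicate.sheafifyOf ⟨q, fun _ => rfl⟩, hball W hWV _ continuous_const ?_⟩
  rintro ⟨_, y, hy, rfl⟩
  exact hy

/-- A section of the sheaf generated by `a` is constant along a path in a fibre of `a`. -/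
theorem generatedReals_eq_of_path {a : X → ℝ} {U : Opens X} {s : U → ℝ}
    (hs : (generatedReals a).pred s) {c : unitInterval → U} (hc : Continuous c)
    (hac : ∀ t, a (c t) = a (c 0)) : s (c 1) = s (c 0) := by
  have : IsLocallyConstant (s ∘ c) := by
    refine (IsLocallyConstant.iff_exists_open _).2 fun t => ?_
    obtain ⟨V, m, i, F, -, h⟩ := hs (c t)
    refine ⟨{u | (c u : X) ∈ V}, V.isOpen.preimage (continuous_subtype_val.comp hc), m,
      fun u hu => ?_⟩
    have h1 := h ⟨c u, hu⟩
    have h2 := h ⟨c t, m⟩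
    simp only [hac] at h1 h2
    exact h1.trans h2.symm
  exact this.apply_eq_of_preconnectedSpace 1 0

/-- Continuous paths `seg x y` from `x` to `y`, which play the role of line segments, for which the
space is locally convex and the function `a` is affine. -/
structure AffineSegments (a : X → ℝ) where
  /-- The segment from `x` to `y`. -/
  seg : X → X → unitInterval → X
  continuous_seg : ∀ x y, Continuous (seg x y)
  seg_zero : ∀ x y, seg x y 0 = x
  seg_one : ∀ x y, seg x y 1 = y
  apply_seg : ∀ x y t, a (seg x y t) = (1 - t) * a x + t * a y
  exists_convex : ∀ (U : Opens X), ∀ p ∈ U,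
    ∃ W : Opens X, p ∈ W ∧ W ≤ U ∧ ∀ x ∈ W, ∀ y ∈ W, ∀ t, seg x y t ∈ W

namespace AffineSegments

variable {a : X → ℝ}

/-- The same segments serve the function `-a`. -/
def neg (γ : AffineSegments a) : AffineSegments (fun x => -a x) where
  seg := γ.seg
  continuous_seg := γ.continuous_seg
  seg_zero := γ.seg_zero
  seg_one := γ.seg_one
  apply_seg x y t := by rw [γ.apply_seg]; ring
  exists_convex := γ.exists_convex

/-- The fibres of `a` in a convex open set are connected by segments, so that a section of the sheaf
generated by `a` is globally a function of `a` there. -/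
theorem section_eq_of_eq (γ : AffineSegments a) {U W : Opens X} (hWU : W ≤ U)
    (hW : ∀ x ∈ W, ∀ y ∈ W, ∀ t, γ.seg x y t ∈ W) {s : U → ℝ} (hs : (generatedReals a).pred s)
    {x y : X} (hx : x ∈ W) (hy : y ∈ W) (h : a x = a y) :
    s ⟨x, hWU hx⟩ = s ⟨y, hWU hy⟩ := by
  have := generatedReals_eq_of_path hs (c := fun t => ⟨γ.seg x y t, hWU (hW x hx y hy t)⟩)
    ((γ.continuous_seg x y).subtype_mk _) (fun t => by
      simp only [γ.apply_seg, h, Set.Icc.coe_zero]; ring)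
  simp only [γ.seg_zero, γ.seg_one] at this
  exact this.symm

/-- To the right of a value `a p`, a continuous function of `a` on a convex open set is a continuous
function of the real variable `a`: either `a p` is the maximum of `a`, or a segment on which `a`
increases is a continuous section of `a`. -/
theorem exists_right_factor (γ : AffineSegments a) {W : Opens X}
    (hW : ∀ x ∈ W, ∀ y ∈ W, ∀ t, γ.seg x y t ∈ W) {f : W → ℝ} (hf : Continuous f)
    (hfib : ∀ x y : W, a x = a y → f x = f y) (p : W) :
    ∃ F : ℝ → ℝ, Continuous F ∧ (∀ r ≤ a p, F r = f p) ∧ ∃ η > 0, ∀ x : W, a p ≤ a x →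
      a x ≤ a p + η → f x = F (a x) := by
  by_cases h : ∃ z : W, a p < a z
  · obtain ⟨z, hz⟩ := h
    have hη : 0 < a z - a p := sub_pos.2 hz
    let c : unitInterval → W := fun t => ⟨γ.seg p z t, hW p p.2 z z.2 t⟩
    have hc : Continuous c := (γ.continuous_seg p z).subtype_mk _
    have hc0 : c 0 = p := Subtype.ext (γ.seg_zero _ _)
    refine ⟨fun r => f (c (Set.projIcc 0 1 zero_le_one ((r - a p) / (a z - a p)))),
      hf.comp (hc.comp (continuous_projIcc.comp (by fun_prop))), fun r hr => ?_, _, hη,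
      fun x hx hx' => ?_⟩
    · dsimp only
      rw [Set.projIcc_of_le_left _ (div_nonpos_of_nonpos_of_nonneg (sub_nonpos.2 hr) hη.le)]
      exact congrArg f hc0
    · refine hfib _ _ ?_
      have hmem : (a x - a p) / (a z - a p) ∈ Set.Icc (0 : ℝ) 1 :=
        ⟨div_nonneg (sub_nonneg.2 hx) hη.le, (div_le_one hη).2 (by linarith)⟩
      rw [Set.projIcc_of_mem _ hmem]
      simp only [c, γ.apply_seg]
      field_simp
      ring
  · push Not at h
    exact ⟨fun _ => f p, continuous_const, fun _ _ => rfl, 1, one_pos,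
      fun x hx _ => hfib _ _ (le_antisymm (h x) hx)⟩

/-- A continuous function that is constant on the fibres of `a` in each convex open set is a section
of the sheaf generated by `a`. -/
theorem generatedReals_of_fibres (γ : AffineSegments a) (ha : Continuous a) {U : Opens X}
    {f : U → ℝ} (hf : Continuous f)
    (hfib : ∀ (W : Opens X) (hWU : W ≤ U), (∀ x ∈ W, ∀ y ∈ W, ∀ t, γ.seg x y t ∈ W) →
      ∀ x y : W, a x = a y → f ⟨x, hWU x.2⟩ = f ⟨y, hWU y.2⟩) :
    (generatedReals a).pred f := by
  intro p
  obtain ⟨W, hpW, hWU, hW⟩ := γ.exists_convex U p p.2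
  have hfW : Continuous (restrict hWU f) := hf.comp (Opens.isOpenEmbedding_of_le hWU).continuous
  obtain ⟨F, hF, hFp, η, hη, hFf⟩ := γ.exists_right_factor hW hfW (hfib W hWU hW) ⟨p, hpW⟩
  obtain ⟨G, hG, hGp, θ, hθ, hGf⟩ := γ.neg.exists_right_factor hW hfW
    (fun x y h => hfib W hWU hW x y (neg_injective h)) ⟨p, hpW⟩
  let V : Opens X := W ⊓ ⟨a ⁻¹' Set.Ioo (a p - θ) (a p + η), isOpen_Ioo.preimage ha⟩
  -- `F` is constant to the left of `a p`, and `r ↦ G (-r)` to the right of it.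
  refine ⟨V, ⟨hpW, by constructor <;> linarith⟩, CategoryTheory.homOfLE (inf_le_left.trans hWU),
    fun r => F r + G (-r) - f p, by fun_prop, ?_⟩
  rintro ⟨x, hxW, hx1, hx2⟩
  change f ⟨x, hWU hxW⟩ = F (a x) + G (-a x) - f p
  rcases le_total (a p) (a x) with h | h
  · have h1 : f ⟨x, hWU hxW⟩ = F (a x) := hFf ⟨x, hxW⟩ h hx2.le
    have h2 : G (-a x) = f p := hGp (-a x) (neg_le_neg h)
    rw [h1, h2]; ring
  · have h1 : f ⟨x, hWU hxW⟩ = G (-a x) :=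
      hGf ⟨x, hxW⟩ (neg_le_neg h) (by change -a x ≤ -a p + θ; linarith)
    have h2 : F (a x) = f p := hFp (a x) h
    rw [h1, h2]; ring

end AffineSegments

/-! ### Cauchy sequences of Dedekind reals -/

theorem IsCauchySequence.exists_forall_abs_lt {U : Opens X} {s : ℕ → U → ℝ}
    (hs : IsCauchySequence s) {ε : ℝ} (hε : 0 < ε) (p : U) :
    ∃ (W : Opens X) (_ : W ≤ U), p.1 ∈ W ∧ ∃ N, ∀ m ≥ N, ∀ n ≥ N, ∀ x : U, x.1 ∈ W →
      |s m x - s n x| < ε := by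
  obtain ⟨W, hWU, hpW, N, hN⟩ := hs U le_rfl (fun _ => ε) ⟨continuous_const, fun _ => hε⟩ p p.2
  exact ⟨W, hWU, hpW, N, fun m hm n hn x hx => hN m hm n hn ⟨x, hx⟩⟩

theorem IsCauchySequence.cauchySeq {U : Opens X} {s : ℕ → U → ℝ}
    (hs : IsCauchySequence s) (p : U) : CauchySeq fun n => s n p := by
  refine Metric.cauchySeq_iff.2 fun ε hε => ?_
  obtain ⟨W, -, hpW, N, hN⟩ := hs.exists_forall_abs_lt hε p
  exact ⟨N, fun m hm n hn => hN m hm n hn p hpW⟩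

theorem IsCauchySequence.tendstoLocallyUniformly {U : Opens X} {s : ℕ → U → ℝ}
    (hs : IsCauchySequence s) {f : U → ℝ}
    (hf : ∀ p, Filter.Tendsto (fun n => s n p) Filter.atTop (nhds (f p))) :
    TendstoLocallyUniformly s f Filter.atTop := by
  refine Metric.tendstoLocallyUniformly_iff.2 fun ε hε p => ?_
  obtain ⟨W, -, hpW, N, hN⟩ := hs.exists_forall_abs_lt (half_pos hε) p
  refine ⟨{x | x.1 ∈ W}, (W.isOpen.preimage continuous_subtype_val).mem_nhds hpW,
    Filter.eventually_atTop.2 ⟨N, fun n hn x hx => ?_⟩⟩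
  have : |f x - s n x| ≤ ε / 2 := le_of_tendsto ((hf x).sub_const (s n x)).abs
    (Filter.eventually_atTop.2 ⟨N, fun m hm => (hN m hm n hn x hx).le⟩)
  exact this.trans_lt (half_lt_self hε)

theorem IsCauchySequence.convergesTo {U : Opens X} {s : ℕ → U → ℝ}
    (hs : IsCauchySequence s) {f : U → ℝ}
    (hf : ∀ p, Filter.Tendsto (fun n => s n p) Filter.atTop (nhds (f p))) : ConvergesTo s f := by
  intro V hV ε ⟨hεc, hε⟩ p hp
  have hεc : Continuous ε := hεc
  obtain ⟨W, hWV, hpW, N, hN⟩ := hs V hV (fun x => ε x / 2)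
    ⟨hεc.div_const 2, fun x => half_pos (hε x)⟩ p hp
  refine ⟨W, hWV, hpW, N, fun n hn x => ?_⟩
  refine lt_of_le_of_lt ?_ (half_lt_self (hε ⟨x, hWV x.2⟩))
  exact le_of_tendsto ((hf ⟨x, hV (hWV x.2)⟩).const_sub _).abs
    (Filter.eventually_atTop.2 ⟨N, fun m hm => (hN n hn m hm x).le⟩)

theorem AffineSegments.isCompleteMetric {a : X → ℝ} (γ : AffineSegments a) (ha : Continuous a) :
    IsCompleteMetric (generatedReals a) where
  isSubsheaf := generatedReals_isSubsheaf ha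
  dist_mem _ _ _ := generatedReals_sdist
  dist_nonneg _ _ _ _ _ _ := abs_nonneg _
  dist_eq_zero U f g _ _ := by
    simp only [funext_iff, sdist, abs_eq_zero, sub_eq_zero]
  dist_comm _ _ _ _ _ := funext fun _ => abs_sub_comm _ _
  dist_triangle _ _ _ _ _ _ _ _ := abs_sub_le _ _ _
  complete U s hs hc := by
    choose f hf using fun p => cauchySeq_tendsto_of_complete (hc.cauchySeq p)
    have hcont : Continuous f := (hc.tendstoLocallyUniformly hf).continuous
      (Filter.Eventually.frequently
        (Filter.Eventually.of_forall fun n => generatedReals_isSubsheaf ha U _ (hs n)))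
    refine ⟨f, γ.generatedReals_of_fibres ha hcont fun W hWU hW x y hxy => ?_, hc.convergesTo hf⟩
    -- The terms `s n` may be functions of `a` only on neighbourhoods that shrink with `n`, but each
    -- is constant on the fibres of `a` in the fixed set `W`, and so is the limit.
    refine tendsto_nhds_unique (hf _) ((hf ⟨y, hWU y.2⟩).congr fun n => ?_)
    exact (γ.section_eq_of_eq hWU hW (hs n) x.2 y.2 hxy).symm

end Generated

section StateSegments

variable {H : Type*} [NormedAddCommGroup H] [InnerProductSpace ℂ H] [CompleteSpace H]
variable {D : Submodule ℂ H} {𝒜 : OStarAlgebra D}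

/-- Mixtures as segments in the state space, on which `a_Q` is affine. -/
def affineSegmentsMix {A : Module.End ℂ D} (hA : A ∈ 𝒜.carrier) :
    AffineSegments (X := TopCat.of (StateSpace 𝒜)) (qValue 𝒜 A) where
  seg := mix
  continuous_seg := continuous_mix
  seg_zero := mix_zero
  seg_one := mix_one
  apply_seg := qValue_mix hA
  exists_convex U _ := exists_convex_nhd U

end StateSegments

end QRNumbers

end

theorem proposition28 {H : Type*} [NormedAddCommGroup H] [InnerProductSpace ℂ H] [CompleteSpace H]
    {D : Submodule ℂ H} (hD : Dense (D : Set H)) (𝒜 : QRNumbers.OStarAlgebra D)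
    (A : Module.End ℂ D) (hA : A ∈ 𝒜.carrier) (hsa : QRNumbers.IsEssentiallySelfAdjoint A) :
    QRNumbers.IsMetricDense (QRNumbers.rationals (TopCat.of (QRNumbers.StateSpace 𝒜)))
        (QRNumbers.qrNumbers 𝒜 A) ∧
      (¬ QRNumbers.IsConstantOperator A →
        QRNumbers.IsCompleteMetric (QRNumbers.qrNumbers 𝒜 A)) := by
  have hc : Continuous (QRNumbers.qValue 𝒜 A) := QRNumbers.continuous_qValue hA
  exact ⟨QRNumbers.rationals_dense (QRNumbers.rationals_isSubsheaf _)
    (QRNumbers.generatedReals_isSubsheaf hc),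
    fun _ => (QRNumbers.affineSegmentsMix hA).isCompleteMetric hc⟩
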